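/- Let $t\in(0,1)$ and let $P_n=\tilde P^{(0,t)}_n$ be the monic polynomials defined by $P_0(y)=1$, $P_1(y)=y$ and $$yP_n(y)=P_{n+1}(y)+t^{n-1}P_n(y)+t^{n-1}P_{n-1}(y),\qquad n\ge 1 .$$ There is exactly one probability measure $\tilde\mu_{0,t}$ on $\mathbb R$ with finite moments of all orders for which the polynomials $(P_n)_{n\ge0}$ are orthogonal (the $t$-free Poisson, or $t$-Marchenko–Pastur, distribution). The measure $\tilde\mu_{0,t}$ is a purely discrete positive measure (it is carried by a countable set) with bounded support. Moreover, $\tilde\mu_{0,t}$ is the vacuum law of $Y_{0,t}(x)$ in the following sense. Let $H$ be a complex Hilbert space (inner product linear in the second variable) and $x\in H$ with $\|x\|=1$. On the algebraic full Fock space $\bigoplus_{n\ge0}H^{\otimes n}$ with vacuum vector $\Omega$, $H^{\otimes 0}=\mathbb C\Omega$, and with the inner product $$\langle x_1\otimes\cdots\otimes x_m,\,y_1\otimes\cdots\otimes y_n\rangle_t=\delta_{m,n}\,t^{n(n-1)/2}\prod_{i=1}^n\langle x_i,y_i\rangle ,$$ let $Y_{0,t}(x)=a_t(x)+a^*(x)+p_t$,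 where, for $n\ge1$, $$a_t(x)(x_1\otimes\cdots\otimes x_n)=t^{n-1}\langle x,x_n\rangle\,x_1\otimes\cdots\otimes x_{n-1},\qquad a_t(x)\Omega=0,$$ $$a^*(x)(x_1\otimes\cdots\otimes x_n)=x_1\otimes\cdots\otimes x_n\otimes x,\qquad a^*(x)\Omega=x,$$ $$p_t(x_1\otimes\cdots\otimes x_n)=t^{n-1}\,x_1\otimes\cdots\otimes x_n,\qquad p_t\Omega=0$$ ($p_t$ is the gauge operator of $T=\mathrm{Id}$). Then a probability measure $\nu$ on $\mathbb R$ with finite moments of all orders satisfies $$\int y^n\,d\nu(y)=\langle\Omega,Y_{0,t}(x)^n\Omega\rangle_t\quad\text{for all } n\ge0$$ if and only if $\nu=\tilde\mu_{0,t}$. -/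

import Mathlib

open MeasureTheory Polynomial
open scoped TensorProduct DirectSum InnerProductSpace

namespace QTFock

/-! ### The `(q,t)`-Poisson polynomials and their orthogonality measure -/

/-- The number `[n]_{q,t} = ∑_{i=1}^{n} q^{i-1} t^{n-i}` (here `i` runs from `0` to `n-1`). -/
noncomputable def qtNumber (q t : ℝ) (n : ℕ) : ℝ :=
  ∑ i ∈ Finset.range n, q ^ i * t ^ (n - 1 - i)

/-- The monic `(q,t)`-Poisson polynomials: `P₀ = 1`, `P₁ = y` and
`y Pₙ = Pₙ₊₁ + [n] Pₙ + [n] Pₙ₋₁` for `n ≥ 1`. -/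
noncomputable def poissonPoly (q t : ℝ) : ℕ → ℝ[X]
  | 0 => 1
  | 1 => X
  | n + 2 => X * poissonPoly q t (n + 1) - C (qtNumber q t (n + 1)) * poissonPoly q t (n + 1)
      - C (qtNumber q t (n + 1)) * poissonPoly q t n

/-- `μ` is a probability measure on `ℝ` with finite moments of all orders for which the
`(q,t)`-Poisson polynomials are orthogonal. -/
structure IsPoissonMeasure (q t : ℝ) (μ : Measure ℝ) : Prop where
  isProbabilityMeasure : IsProbabilityMeasure μ
  integrable_pow : ∀ n : ℕ, Integrable (fun y : ℝ => y ^ n) μ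
  orthogonal : ∀ m n : ℕ, m ≠ n →
    ∫ y, (poissonPoly q t m).eval y * (poissonPoly q t n).eval y ∂μ = 0

/-- A measure on `ℝ` is purely discrete if it is carried by a countable set. -/
def IsPurelyDiscrete (μ : Measure ℝ) : Prop :=
  ∃ S : Set ℝ, S.Countable ∧ μ Sᶜ = 0

/-! ### The algebraic full Fock space with the `(q,t)`-inner product -/

section Fock

variable (H : Type*) [NormedAddCommGroup H] [InnerProductSpace ℂ H]

/-- The algebraic full Fock space `⨁ₙ H^{⊗n}` (algebraic tensor powers, no completion). -/
abbrev Fock : Type _ := ⨁ n : ℕ, ⨂[ℂ]^n H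

/-- The vacuum vector, the unit of `H^{⊗0} = ℂ`. -/
noncomputable def vacuum : Fock H :=
  DirectSum.lof ℂ ℕ (fun n => ⨂[ℂ]^n H) 0 (PiTensorProduct.tprod ℂ (Fin.elim0 : Fin 0 → H))

/-- A copy of a complex vector space `W` on which a scalar `c` acts as its conjugate does on `W`:
linear maps into `ConjCopy W` are the antilinear maps into `W`. -/
def ConjCopy (W : Type*) : Type _ := W

instance (W : Type*) [AddCommGroup W] : AddCommGroup (ConjCopy W) :=
  inferInstanceAs (AddCommGroup W)

noncomputable instance (W : Type*) [AddCommGroup W] [Module ℂ W] : Module ℂ (ConjCopy W) :=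
  Module.compHom W (starRingEnd ℂ)

variable {H}

/-- The functional `y₁ ⊗ ⋯ ⊗ yₙ ↦ ∏ᵢ ⟨xᵢ, yᵢ⟩` on `H^{⊗n}`. -/
noncomputable def innerWith {n : ℕ} (x : Fin n → H) : ⨂[ℂ]^n H →ₗ[ℂ] ℂ :=
  PiTensorProduct.lift ((MultilinearMap.mkPiAlgebra ℂ (Fin n) ℂ).compLinearMap
    fun i => (innerSL ℂ (x i)).toLinearMap)

theorem innerWith_tprod {n : ℕ} (x y : Fin n → H) :
    innerWith x (PiTensorProduct.tprod ℂ y) = ∏ i, ⟪x i, y i⟫_ℂ := by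
  simp [innerWith]

theorem innerWith_update_add {n : ℕ} (x : Fin n → H) (i : Fin n) (a b : H) :
    innerWith (Function.update x i (a + b)) =
      innerWith (Function.update x i a) + innerWith (Function.update x i b) := by
  apply PiTensorProduct.ext
  ext y
  simp only [LinearMap.compMultilinearMap_apply, LinearMap.add_apply, innerWith_tprod]
  rw [← Finset.mul_prod_erase _ _ (Finset.mem_univ i),
    ← Finset.mul_prod_erase _ (fun j => ⟪Function.update x i a j, y j⟫_ℂ) (Finset.mem_univ i),
    ← Finset.mul_prod_erase _ (fun j => ⟪Function.update x i b j, y j⟫_ℂ) (Finset.mem_univ i)]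
  simp only [Function.update_self, inner_add_left, add_mul]
  congr 1 <;> congr 1 <;> refine Finset.prod_congr rfl fun j hj => ?_ <;>
    simp [Function.update_of_ne (Finset.ne_of_mem_erase hj)]

theorem innerWith_update_smul {n : ℕ} (x : Fin n → H) (i : Fin n) (c : ℂ) (a : H) :
    innerWith (Function.update x i (c • a)) =
      starRingEnd ℂ c • innerWith (Function.update x i a) := by
  apply PiTensorProduct.ext
  ext y
  simp only [LinearMap.compMultilinearMap_apply, LinearMap.smul_apply, innerWith_tprod,
    smul_eq_mul]
  rw [← Finset.mul_prod_erase _ _ (Finset.mem_univ i),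
    ← Finset.mul_prod_erase _ (fun j => ⟪Function.update x i a j, y j⟫_ℂ) (Finset.mem_univ i)]
  simp only [Function.update_self, inner_smul_left, mul_assoc]
  congr 2
  refine Finset.prod_congr rfl fun j hj => ?_
  simp [Function.update_of_ne (Finset.ne_of_mem_erase hj)]

variable (H)

/-- The functional `innerWith x` as an antilinear function of each `xᵢ`. -/
noncomputable def innerMulti (n : ℕ) :
    MultilinearMap ℂ (fun _ : Fin n => H) (ConjCopy (⨂[ℂ]^n H →ₗ[ℂ] ℂ)) :=
  MultilinearMap.mk' (fun x => innerWith x)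
    (fun x i a b => innerWith_update_add x i a b)
    (fun x i c a => innerWith_update_smul x i c a)

variable {H}

/-- The undeformed inner product on `H^{⊗n}`, antilinear in the first and linear in the second
variable: `⟨x₁ ⊗ ⋯ ⊗ xₙ, y₁ ⊗ ⋯ ⊗ yₙ⟩ = ∏ᵢ ⟨xᵢ, yᵢ⟩`. -/
noncomputable def tensorInner (n : ℕ) (f : ⨂[ℂ]^n H) : ⨂[ℂ]^n H →ₗ[ℂ] ℂ :=
  PiTensorProduct.lift (innerMulti H n) f

theorem tensorInner_tprod {n : ℕ} (x y : Fin n → H) :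
    tensorInner n (PiTensorProduct.tprod ℂ x) (PiTensorProduct.tprod ℂ y) = ∏ i, ⟪x i, y i⟫_ℂ :=
  (congrArg (fun φ : ⨂[ℂ]^n H →ₗ[ℂ] ℂ => φ (PiTensorProduct.tprod ℂ y))
    (PiTensorProduct.lift.tprod (φ := innerMulti H n) x)).trans (innerWith_tprod x y)

/-- The number of inversions of a permutation, i.e. its length as a word in the adjacent
transpositions. -/
def inversions {n : ℕ} (σ : Equiv.Perm (Fin n)) : ℕ :=
  (Finset.univ.filter fun p : Fin n × Fin n => p.1 < p.2 ∧ σ p.2 < σ p.1).card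

/-- The `(q,t)`-symmetrization operator `t^{n(n-1)/2} ∑_{σ ∈ S(n)} (q/t)^{|σ|} σ` on `H^{⊗n}`. -/
noncomputable def symmetrizer (q t : ℝ) (n : ℕ) : ⨂[ℂ]^n H →ₗ[ℂ] ⨂[ℂ]^n H :=
  ((t : ℂ) ^ n.choose 2) • ∑ σ : Equiv.Perm (Fin n),
    ((q / t : ℝ) : ℂ) ^ inversions σ • (PiTensorProduct.reindex ℂ (fun _ => H) σ).toLinearMap

/-- The `(q,t)`-inner product `∑ₙ ⟨fₙ, P⁽ⁿ⁾ gₙ⟩` on the Fock space, where `P⁽ⁿ⁾` is the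
`(q,t)`-symmetrization operator. -/
noncomputable def fockInner (q t : ℝ) (f g : Fock H) : ℂ :=
  DirectSum.toModule ℂ ℕ ℂ (fun n => tensorInner n (f n) ∘ₗ symmetrizer q t n) g

/-- The vacuum state `X ↦ ⟨Ω, X Ω⟩`. -/
noncomputable def vacuumState (q t : ℝ) (A : Module.End ℂ (Fock H)) : ℂ :=
  fockInner q t (vacuum H) (A (vacuum H))

/-! ### Creation, annihilation and gauge operators -/

/-- The creation operator `x₁ ⊗ ⋯ ⊗ xₙ ↦ x₁ ⊗ ⋯ ⊗ xₙ ⊗ x`. -/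
noncomputable def creation (x : H) : Module.End ℂ (Fock H) :=
  DirectSum.toModule ℂ ℕ _ fun n =>
    DirectSum.lof ℂ ℕ (fun n => ⨂[ℂ]^n H) (n + 1) ∘ₗ
      PiTensorProduct.lift
        ((PiTensorProduct.tprod ℂ : MultilinearMap ℂ (fun _ : Fin (n + 1) => H) _).curryMid
          (Fin.last n) x)

/-- The annihilation operator on `H^{⊗(n+1)}`:
`x₁ ⊗ ⋯ ⊗ xₙ₊₁ ↦ ∑_{k=1}^{n+1} t^{k-1} q^{n+1-k} ⟨x, x_k⟩ x₁ ⊗ ⋯ x̌_k ⋯ ⊗ xₙ₊₁`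
(here `k` runs from `0` to `n`). -/
noncomputable def annihilationAux (q t : ℝ) (x : H) (n : ℕ) :
    ⨂[ℂ]^(n + 1) H →ₗ[ℂ] ⨂[ℂ]^n H :=
  PiTensorProduct.lift (∑ k : Fin (n + 1), ((t : ℂ) ^ (k : ℕ) * (q : ℂ) ^ (n - k)) •
    LinearMap.uncurryMid (M := fun _ : Fin (n + 1) => H) k
      ((innerSL ℂ x).toLinearMap.smulRight
        (PiTensorProduct.tprod ℂ : MultilinearMap ℂ (fun _ : Fin n => H) _)))

/-- The annihilation operator `a_{q,t}(x)`; it kills the vacuum. -/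
noncomputable def annihilation (q t : ℝ) (x : H) : Module.End ℂ (Fock H) :=
  DirectSum.toModule ℂ ℕ _ fun n =>
    match n with
    | 0 => 0
    | n + 1 => DirectSum.lof ℂ ℕ (fun n => ⨂[ℂ]^n H) n ∘ₗ annihilationAux q t x n

/-- The gauge operator on `H^{⊗(n+1)}`:
`x₁ ⊗ ⋯ ⊗ xₙ₊₁ ↦ ∑_{k=1}^{n+1} t^{k-1} q^{n+1-k} x₁ ⊗ ⋯ x̌_k ⋯ ⊗ xₙ₊₁ ⊗ T x_k`
(here `k` runs from `0` to `n`). -/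
noncomputable def gaugeAux (q t : ℝ) (T : H →L[ℂ] H) (n : ℕ) :
    ⨂[ℂ]^(n + 1) H →ₗ[ℂ] ⨂[ℂ]^(n + 1) H :=
  PiTensorProduct.lift (∑ k : Fin (n + 1), ((t : ℂ) ^ (k : ℕ) * (q : ℂ) ^ (n - k)) •
    LinearMap.uncurryMid (M := fun _ : Fin (n + 1) => H) k
      ((PiTensorProduct.tprod ℂ : MultilinearMap ℂ (fun _ : Fin (n + 1) => H) _).curryMid
        (Fin.last n) ∘ₗ T.toLinearMap))

/-- The gauge operator of `T`; it kills the vacuum. -/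
noncomputable def gauge (q t : ℝ) (T : H →L[ℂ] H) : Module.End ℂ (Fock H) :=
  DirectSum.toModule ℂ ℕ _ fun n =>
    match n with
    | 0 => 0
    | n + 1 => DirectSum.lof ℂ ℕ (fun n => ⨂[ℂ]^n H) (n + 1) ∘ₗ gaugeAux q t T n

/-- The operator `Y_{q,t}(x)`: annihilation plus creation plus the gauge operator of `T`. -/
noncomputable def opY (q t : ℝ) (T : H →L[ℂ] H) (x : H) : Module.End ℂ (Fock H) :=
  annihilation q t x + creation x + gauge q t T

/-- `μ` is a law of the operator `A` in the vacuum state: a probability measure on `ℝ` with finite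
moments of all orders, given by `∫ yⁿ dμ = ⟨Ω, Aⁿ Ω⟩`. -/
structure IsVacuumLaw (q t : ℝ) (A : Module.End ℂ (Fock H)) (μ : Measure ℝ) : Prop where
  isProbabilityMeasure : IsProbabilityMeasure μ
  integrable_pow : ∀ n : ℕ, Integrable (fun y : ℝ => y ^ n) μ
  moment_eq : ∀ n : ℕ, vacuumState q t (A ^ n) = ((∫ y, y ^ n ∂μ : ℝ) : ℂ)

end Fock

end QTFock

namespace QTFock

/-! ### Compactly supported measures and their moments -/

/-! At `q = 0` the recurrence coefficients are powers of `t`, so with `s = √t` the normalised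
polynomials belong to a Jacobi matrix whose entries decay geometrically. It is a norm-convergent sum
of finite-rank symmetric operators, hence compact and symmetric, and its spectral measure at `e 0`
is a sum of point masses at eigenvalues, within `[-‖J‖, ‖J‖]`. Orthogonality follows because `P_n(J)
e 0` is a multiple of `e n` (`aeval_jacobiOp_poissonPoly`).

Uniqueness: orthogonality to `P_0 = 1` fixes every `∫ P_n`, the `P_n` span all polynomials, so the
moments are fixed, and a boundedly supported measure is determined by its moments among all finite
measures having moments (`ext_of_moments`).

Vacuum law: `P_n(Y) Ω = x ⊗ ⋯ ⊗ x` (`aeval_opY_poissonPoly`) is orthogonal to `Ω` for `n ≥ 1`. Thus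
`p ↦ ⟨Ω, p(Y) Ω⟩` and `p ↦ ∫ p dμ` agree on the `P_n`, hence on all polynomials, and determinacy
applies again. -/

theorem integral_polynomial_eq_of_moments {μ ν : Measure ℝ}
    (hμ : ∀ n : ℕ, Integrable (fun y : ℝ => y ^ n) μ)
    (hν : ∀ n : ℕ, Integrable (fun y : ℝ => y ^ n) ν)
    (h : ∀ n : ℕ, ∫ y, y ^ n ∂μ = ∫ y, y ^ n ∂ν) (p : ℝ[X]) :
    ∫ y, p.eval y ∂μ = ∫ y, p.eval y ∂ν := by
  simp only [eval_eq_sum_range]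
  rw [integral_finsetSum _ fun i _ => (hμ i).const_mul _,
    integral_finsetSum _ fun i _ => (hν i).const_mul _]
  simp only [integral_const_mul, h]

theorem integrable_eval {μ : Measure ℝ} (hμ : ∀ n : ℕ, Integrable (fun y : ℝ => y ^ n) μ)
    (p : ℝ[X]) : Integrable (fun y => p.eval y) μ := by
  simp only [eval_eq_sum_range]
  exact integrable_finsetSum _ fun i _ => (hμ i).const_mul _

theorem integrable_of_ae_mem_Icc {μ : Measure ℝ} [IsFiniteMeasure μ] {R : ℝ}
    (hR : ∀ᵐ y ∂μ, y ∈ Set.Icc (-R) R) {f : ℝ → ℝ} (hf : Continuous f) : Integrable f μ := by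
  obtain ⟨C, hC⟩ := isCompact_Icc.exists_bound_of_continuousOn
    (hf.continuousOn (s := Set.Icc (-R) R))
  exact Integrable.of_bound hf.aestronglyMeasurable C (hR.mono hC)

/-- A finite measure all of whose even moments are at most `C * R ^ (2 * n)` is carried by
`[-R, R]`. -/
theorem ae_mem_Icc_of_moments_le {μ : Measure ℝ} [IsFiniteMeasure μ] {R C : ℝ} (hR : 0 ≤ R)
    (hμ : ∀ n : ℕ, Integrable (fun y : ℝ => y ^ n) μ)
    (h : ∀ n : ℕ, ∫ y, y ^ (2 * n) ∂μ ≤ C * R ^ (2 * n)) :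
    ∀ᵐ y ∂μ, y ∈ Set.Icc (-R) R := by
  -- Markov's inequality for `y ^ (2 * n)` bounds the mass of `|y| ≥ r` by `C * (R / r) ^ (2 * n)`,
  -- which tends to `0` when `r > R`.
  have key : ∀ k : ℕ, μ {y | R + 1 / ((k : ℝ) + 1) ≤ |y|} = 0 := by
    intro k
    set r : ℝ := R + 1 / ((k : ℝ) + 1) with hr
    have hRr : R < r := by rw [hr]; linarith [show (0 : ℝ) < 1 / ((k : ℝ) + 1) by positivity]
    have hr0 : 0 < r := hR.trans_lt hRr
    have hbound : ∀ n : ℕ, μ.real {y | r ≤ |y|} ≤ C * (R ^ 2 / r ^ 2) ^ n := by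
      intro n
      have h1 := mul_meas_ge_le_integral_of_nonneg (μ := μ) (f := fun y : ℝ => y ^ (2 * n))
        (Filter.Eventually.of_forall fun y => by simp only [pow_mul]; positivity) (hμ (2 * n))
        (r ^ (2 * n))
      have h2 : μ.real {y | r ≤ |y|} ≤ μ.real {y | r ^ (2 * n) ≤ y ^ (2 * n)} := by
        refine measureReal_mono fun y hy => ?_
        have : r ^ (2 * n) ≤ |y| ^ (2 * n) := pow_le_pow_left₀ hr0.le hy _
        rwa [Even.pow_abs (even_two_mul n)] at this
      rw [div_pow, ← pow_mul, ← pow_mul, mul_div_assoc', le_div_iff₀ (by positivity), mul_comm]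
      exact (mul_le_mul_of_nonneg_left h2 (by positivity)).trans (h1.trans (h n))
    have hlim : Filter.Tendsto (fun n : ℕ => C * (R ^ 2 / r ^ 2) ^ n) Filter.atTop (nhds (C * 0)) :=
      (tendsto_pow_atTop_nhds_zero_of_lt_one (by positivity)
        ((div_lt_one (by positivity)).2 (pow_lt_pow_left₀ hRr hR two_ne_zero))).const_mul C
    have h0 : μ.real {y | r ≤ |y|} ≤ 0 := by
      simpa using ge_of_tendsto' hlim hbound
    exact (measureReal_eq_zero_iff).1 (le_antisymm h0 measureReal_nonneg)
  have hall : ∀ᵐ y ∂μ, ∀ k : ℕ, ¬ R + 1 / ((k : ℝ) + 1) ≤ |y| :=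
    ae_all_iff.2 fun k => measure_eq_zero_iff_ae_notMem.1 (key k)
  filter_upwards [hall] with y hy
  rw [Set.mem_Icc, ← abs_le]
  by_contra! hlt
  obtain ⟨k, hk⟩ := exists_nat_one_div_lt (sub_pos.2 hlt)
  exact hy k (by linarith)

/-- Two finite measures on `[-R, R]` with the same moments coincide. -/
theorem ext_of_moments_of_ae_mem_Icc {μ ν : Measure ℝ} [IsFiniteMeasure μ] [IsFiniteMeasure ν]
    {R : ℝ} (hμ : ∀ᵐ y ∂μ, y ∈ Set.Icc (-R) R) (hν : ∀ᵐ y ∂ν, y ∈ Set.Icc (-R) R)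
    (h : ∀ n : ℕ, ∫ y, y ^ n ∂μ = ∫ y, y ^ n ∂ν) : μ = ν := by
  refine ext_of_forall_integral_eq_of_IsFiniteMeasure fun f => ?_
  refine eq_of_forall_dist_le fun ε hε => ?_
  -- The added `1` keeps `M` positive even if both measures vanish; a Weierstrass approximation
  -- within `ε / M` then costs at most `ε` over both measures.
  set M : ℝ := μ.real Set.univ + ν.real Set.univ + 1 with hM
  have hMpos : 0 < M := by positivity
  obtain ⟨p, hp⟩ := exists_polynomial_near_of_continuousOn (-R) R f f.continuous.continuousOn
    (ε / M) (by positivity)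
  have bound : ∀ ρ : Measure ℝ, IsFiniteMeasure ρ → (∀ᵐ y ∂ρ, y ∈ Set.Icc (-R) R) →
      |∫ y, f y ∂ρ - ∫ y, p.eval y ∂ρ| ≤ ε / M * ρ.real Set.univ := by
    intro ρ _ hρ
    rw [← integral_sub (integrable_of_ae_mem_Icc hρ f.continuous)
      (integrable_of_ae_mem_Icc hρ p.continuous), ← Real.norm_eq_abs]
    refine norm_integral_le_of_norm_le_const (hρ.mono fun y hy => ?_)
    rw [Real.norm_eq_abs, abs_sub_comm]
    exact (hp y hy).le
  have hpp := integral_polynomial_eq_of_moments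
    (fun n => integrable_of_ae_mem_Icc hμ (continuous_pow n))
    (fun n => integrable_of_ae_mem_Icc hν (continuous_pow n)) h p
  have h1 := abs_le.1 (bound μ inferInstance hμ)
  have h2 := abs_le.1 (bound ν inferInstance hν)
  have h3 : ε / M * μ.real Set.univ + ε / M * ν.real Set.univ ≤ ε := by
    rw [← mul_add, div_mul_eq_mul_div, div_le_iff₀ hMpos]
    exact mul_le_mul_of_nonneg_left (by linarith) hε.le
  rw [Real.dist_eq, abs_le]
  constructor <;> linarith [h1.1, h1.2, h2.1, h2.2]

/-- A compactly supported finite measure is determined by its moments among all finite measures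
with finite moments. -/
theorem ext_of_moments {μ ν : Measure ℝ} [IsFiniteMeasure μ] [IsFiniteMeasure ν]
    {R : ℝ} (hR : 0 ≤ R) (hμ : ∀ᵐ y ∂μ, y ∈ Set.Icc (-R) R)
    (hν : ∀ n : ℕ, Integrable (fun y : ℝ => y ^ n) ν)
    (h : ∀ n : ℕ, ∫ y, y ^ n ∂μ = ∫ y, y ^ n ∂ν) : μ = ν := by
  refine ext_of_moments_of_ae_mem_Icc hμ ?_ h
  -- The even moments of `ν` are those of `μ`, so their growth forces `ν` onto the same interval.
  refine ae_mem_Icc_of_moments_le (C := μ.real Set.univ) hR hν fun n => ?_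
  rw [← h, mul_comm (μ.real _)]
  refine (Real.le_norm_self _).trans (norm_integral_le_of_norm_le_const (hμ.mono fun y hy => ?_))
  rw [norm_pow, Real.norm_eq_abs]
  exact pow_le_pow_left₀ (abs_nonneg _) (abs_le.2 hy) _

/-! ### The spectral measure of a compact symmetric operator -/

/-- The probability measure with given point masses. -/
theorem exists_discrete_measure {m : ℝ → ℝ} (hm : ∀ a, 0 ≤ m a) (hsum : HasSum m 1) {R : ℝ}
    (hR : ∀ a, m a ≠ 0 → |a| ≤ R) :
    ∃ μ : Measure ℝ, IsProbabilityMeasure μ ∧ IsPurelyDiscrete μ ∧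
      (∀ᵐ y ∂μ, y ∈ Set.Icc (-R) R) ∧ ∀ n : ℕ, ∫ y, y ^ n ∂μ = ∑' a, m a * a ^ n := by
  have hone : HasSum (fun a => ENNReal.ofReal (m a)) 1 := by
    rw [← ENNReal.ofReal_one, ← hsum.tsum_eq, ENNReal.ofReal_tsum_of_nonneg hm hsum.summable]
    exact ENNReal.summable.hasSum
  -- Summability makes the support of a `PMF` countable, which gives discreteness.
  let p : PMF ℝ := ⟨_, hone⟩
  have hp : ∀ a, p a = ENNReal.ofReal (m a) := fun _ => rfl
  have hIcc : ∀ᵐ y ∂p.toMeasure, y ∈ Set.Icc (-R) R := by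
    refine (PMF.toMeasure_apply_eq_zero_iff p measurableSet_Icc.compl).2
      (Set.disjoint_left.2 fun a ha hn => hn ?_)
    rw [Set.mem_Icc, ← abs_le]
    refine hR a fun h0 => ?_
    rw [PMF.mem_support_iff, hp, h0] at ha
    simp at ha
  refine ⟨p.toMeasure, inferInstance, ⟨p.support, p.support_countable, ?_⟩, hIcc, fun n => ?_⟩
  · rw [PMF.toMeasure_apply_eq_zero_iff p p.support_countable.measurableSet.compl]
    exact disjoint_compl_right
  · rw [PMF.integral_eq_tsum _ _ (integrable_of_ae_mem_Icc hIcc (continuous_pow n))]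
    refine tsum_congr fun a => ?_
    rw [hp, ENNReal.toReal_ofReal (hm a), smul_eq_mul]

section Spectral

variable {E : Type*} [NormedAddCommGroup E] [InnerProductSpace ℝ E] [CompleteSpace E]

/-- A compact symmetric operator on a real Hilbert space has a purely discrete spectral measure
at every unit vector. -/
theorem exists_discrete_spectral_measure (T : E →L[ℝ] E) (hT : IsCompactOperator T)
    (hsymm : T.IsSymmetric) (x : E) (hx : ‖x‖ = 1) :
    ∃ μ : Measure ℝ, IsProbabilityMeasure μ ∧ IsPurelyDiscrete μ ∧
      (∀ᵐ y ∂μ, y ∈ Set.Icc (-‖T‖) ‖T‖) ∧ ∀ n : ℕ, ∫ y, y ^ n ∂μ = ⟪x, (T ^ n) x⟫_ℝ := by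
  have : ∀ a : ℝ, CompleteSpace (Module.End.eigenspace (T : Module.End ℝ E) a) := by
    intro a
    have hc : IsClosed (Module.End.eigenspace (T : Module.End ℝ E) a : Set E) := by
      have : (Module.End.eigenspace (T : Module.End ℝ E) a : Set E) = {v | T v = a • v} := by
        ext v; simp
      rw [this]
      exact isClosed_eq T.continuous (continuous_const_smul a)
    exact hc.completeSpace_coe
  -- The spectral theorem for compact symmetric operators, with the kernel included as the
  -- eigenspace of `0`.
  have hsum : IsHilbertSum ℝ (fun a : ℝ => Module.End.eigenspace (T : Module.End ℝ E) a)
      (fun a => (Module.End.eigenspace (T : Module.End ℝ E) a).subtypeₗᵢ) := by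
    refine IsHilbertSum.mkInternal (F := Module.End.eigenspace (T : Module.End ℝ E))
      hsymm.orthogonalFamily_eigenspaces ?_
    rw [Submodule.topologicalClosure_eq_top_iff.2
      (ContinuousLinearMap.orthogonalComplement_iSup_eigenspaces_eq_bot hT hsymm)]
  -- `w a` is the component of `x` in the `a`-eigenspace; the measure will have mass `‖w a‖ ^ 2` at
  -- `a`.
  set w := hsum.linearIsometryEquiv x with hw
  have hwx : HasSum (fun a => ((w a : Module.End.eigenspace (T : Module.End ℝ E) a) : E)) x := by
    simpa [hw] using hsum.hasSum_linearIsometryEquiv_symm w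
  have hev : ∀ a, T (w a : E) = a • (w a : E) := fun a =>
    Module.End.mem_eigenspace_iff.1 (w a).2
  have hevpow : ∀ a (n : ℕ), (T ^ n) (w a : E) = a ^ n • (w a : E) := by
    intro a n
    induction n with
    | zero => simp
    | succ n ih =>
      rw [pow_succ, mul_apply_eq_comp, hev, map_smul, ih, smul_smul, mul_comm, pow_succ]
  have hinner : ∀ a, ⟪x, (w a : E)⟫_ℝ = ‖(w a : E)‖ ^ 2 := by
    intro a
    have h1 := hwx.mapL (innerSL ℝ (w a : E))
    have h2 : HasSum (fun b => ⟪(w a : E), (w b : E)⟫_ℝ) ⟪(w a : E), (w a : E)⟫_ℝ := by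
      refine hasSum_single a fun b hb => ?_
      exact hsymm.orthogonalFamily_eigenspaces hb.symm (w a) (w b)
    rw [real_inner_comm, ← real_inner_self_eq_norm_sq]
    exact h1.unique h2
  have hmom : ∀ n : ℕ, HasSum (fun a => ‖(w a : E)‖ ^ 2 * a ^ n) ⟪x, (T ^ n) x⟫_ℝ := by
    intro n
    have h1 := (hwx.mapL (T ^ n)).mapL (innerSL ℝ x)
    simp only [hevpow, map_smul, innerSL_apply_apply, hinner, smul_eq_mul] at h1
    simpa only [mul_comm] using h1
  have hbound : ∀ a, ‖(w a : E)‖ ^ 2 ≠ 0 → |a| ≤ ‖T‖ := by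
    intro a ha
    have := T.le_opNorm (w a : E)
    rw [hev, norm_smul, Real.norm_eq_abs] at this
    exact le_of_mul_le_mul_right this ((norm_nonneg _).lt_of_ne' (by simpa using ha))
  obtain ⟨μ, h1, h2, h3, h4⟩ := exists_discrete_measure (fun _ => by positivity)
    (show HasSum (fun a => ‖(w a : E)‖ ^ 2) 1 by simpa [hx] using hmom 0) hbound
  exact ⟨μ, h1, h2, h3, fun n => (h4 n).trans (hmom n).tsum_eq⟩

end Spectral

/-! ### The Poisson polynomials at `q = 0` -/

theorem qtNumber_zero_left_succ (t : ℝ) (n : ℕ) : qtNumber 0 t (n + 1) = t ^ n := by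
  rw [qtNumber, Finset.sum_range_succ']
  simp

theorem poissonPoly_zero_left_add_two (t : ℝ) (n : ℕ) :
    poissonPoly 0 t (n + 2) = X * poissonPoly 0 t (n + 1) - C (t ^ n) * poissonPoly 0 t (n + 1)
      - C (t ^ n) * poissonPoly 0 t n := by
  rw [poissonPoly, qtNumber_zero_left_succ]

/-- The span contains `1` and, by the recurrence, is stable under multiplication by `X`. Hence a
linear functional on polynomials is determined by its values on this family. -/
theorem span_poissonPoly (q t : ℝ) : Submodule.span ℝ (Set.range (poissonPoly q t)) = ⊤ := by
  set S := Submodule.span ℝ (Set.range (poissonPoly q t)) with hS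
  have hmem : ∀ n, poissonPoly q t n ∈ S := fun n => Submodule.subset_span ⟨n, rfl⟩
  have hX : ∀ p ∈ S, X * p ∈ S := by
    intro p hp
    induction hp using Submodule.span_induction with
    | mem p hp =>
      obtain ⟨n, rfl⟩ := hp
      cases n with
      | zero => simpa [poissonPoly] using hmem 1
      | succ n =>
        have h : X * poissonPoly q t (n + 1) = poissonPoly q t (n + 2)
            + qtNumber q t (n + 1) • poissonPoly q t (n + 1)
            + qtNumber q t (n + 1) • poissonPoly q t n := by
          rw [poissonPoly, smul_eq_C_mul, smul_eq_C_mul]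
          ring
        rw [h]
        exact S.add_mem (S.add_mem (hmem _) (S.smul_mem _ (hmem _))) (S.smul_mem _ (hmem _))
    | zero => simp
    | add p r _ _ hp hr => rw [mul_add]; exact S.add_mem hp hr
    | smul a p _ hp => rw [mul_smul_comm]; exact S.smul_mem a hp
  have hpow : ∀ n : ℕ, (X : ℝ[X]) ^ n ∈ S := by
    intro n
    induction n with
    | zero => simpa [poissonPoly] using hmem 0
    | succ n ih => rw [pow_succ']; exact hX _ ih
  refine eq_top_iff.2 fun p _ => ?_
  rw [p.as_sum_range_C_mul_X_pow]
  refine S.sum_mem fun i _ => ?_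
  rw [← smul_eq_C_mul]
  exact S.smul_mem _ (hpow i)

theorem IsPoissonMeasure.integral_poissonPoly {q t : ℝ} {μ : Measure ℝ}
    (hμ : IsPoissonMeasure q t μ) (n : ℕ) :
    ∫ y, (poissonPoly q t n).eval y ∂μ = if n = 0 then 1 else 0 := by
  have := hμ.isProbabilityMeasure
  split_ifs with h
  · simp [h, poissonPoly]
  · simpa [poissonPoly] using hμ.orthogonal n 0 h

/-- The moments of a Poisson measure are determined by the Poisson polynomials. -/
theorem IsPoissonMeasure.integral_eval_eq {q t : ℝ} {μ ν : Measure ℝ}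
    (hμ : IsPoissonMeasure q t μ) (hν : IsPoissonMeasure q t ν) (p : ℝ[X]) :
    ∫ y, p.eval y ∂μ = ∫ y, p.eval y ∂ν := by
  have hp : p ∈ Submodule.span ℝ (Set.range (poissonPoly q t)) := by simp [span_poissonPoly]
  induction hp using Submodule.span_induction with
  | mem p hp =>
    obtain ⟨n, rfl⟩ := hp
    rw [hμ.integral_poissonPoly, hν.integral_poissonPoly]
  | zero => simp
  | add p r _ _ hp hr =>
    simp only [eval_add]
    rw [integral_add (integrable_eval hμ.integrable_pow p) (integrable_eval hμ.integrable_pow r),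
      integral_add (integrable_eval hν.integrable_pow p) (integrable_eval hν.integrable_pow r),
      hp, hr]
  | smul a p _ hp => simp only [eval_smul, smul_eq_mul, integral_const_mul, hp]

theorem IsPoissonMeasure.moments_eq {q t : ℝ} {μ ν : Measure ℝ}
    (hμ : IsPoissonMeasure q t μ) (hν : IsPoissonMeasure q t ν) (n : ℕ) :
    ∫ y, y ^ n ∂μ = ∫ y, y ^ n ∂ν := by
  simpa using hμ.integral_eval_eq hν (X ^ n)

/-! ### The Jacobi operator -/

section Jacobi

open InnerProductSpace

variable {E : Type*} [NormedAddCommGroup E] [InnerProductSpace ℝ E]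

/-- The part of the Jacobi operator that links `e n` and `e (n + 1)`. -/
noncomputable def jacobiTerm (e : ℕ → E) (s : ℝ) (n : ℕ) : E →L[ℝ] E :=
  s ^ n • (rankOne ℝ (e n) (e (n + 1)) + rankOne ℝ (e (n + 1)) (e n)) +
    (s ^ 2) ^ n • rankOne ℝ (e (n + 1)) (e (n + 1))

/-- The Jacobi operator `e n ↦ s ^ n e (n + 1) + s ^ (2 * (n - 1)) e n + s ^ (n - 1) e (n - 1)`,
where `e 0 ↦ e 1`. -/
noncomputable def jacobiOp (e : ℕ → E) (s : ℝ) : E →L[ℝ] E :=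
  ∑' n, jacobiTerm e s n

theorem isCompactOperator_rankOne (x y : E) : IsCompactOperator (rankOne ℝ x y) := by
  rw [rankOne_def']
  have h : IsCompactOperator (id : ℝ → ℝ) :=
    (isCompactOperator_id_iff_finiteDimensional (𝕜 := ℝ)).2 inferInstance
  exact (h.comp_clm (innerSL ℝ y)).clm_comp (ContinuousLinearMap.toSpanSingleton ℝ x)

theorem isCompactOperator_jacobiTerm (e : ℕ → E) (s : ℝ) (n : ℕ) :
    IsCompactOperator (jacobiTerm e s n) :=
  (((isCompactOperator_rankOne _ _).add (isCompactOperator_rankOne _ _)).smul (s ^ n)).add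
    ((isCompactOperator_rankOne _ _).smul ((s ^ 2) ^ n))

theorem inner_jacobiTerm_left (e : ℕ → E) (s : ℝ) (n : ℕ) (x y : E) :
    ⟪jacobiTerm e s n x, y⟫_ℝ = ⟪x, jacobiTerm e s n y⟫_ℝ := by
  simp only [jacobiTerm, add_apply, smul_apply,
    rankOne_apply, inner_add_left, inner_add_right, inner_smul_left, inner_smul_right, map_pow,
    conj_trivial, real_inner_comm x]
  ring

variable [CompleteSpace E] {e : ℕ → E} {s : ℝ}

/-- Each rank-one operator has norm `1`, so the `n`-th term has norm at most `3 * s ^ n`. Without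
summability the `tsum` in `jacobiOp` would be the default `0`; convergence in operator norm also
passes compactness to the limit. -/
theorem summable_jacobiTerm (he : Orthonormal ℝ e) (hs0 : 0 ≤ s) (hs1 : s < 1) :
    Summable (jacobiTerm e s) := by
  refine Summable.of_norm_bounded ((summable_geometric_of_lt_one hs0 hs1).mul_left 3) fun n => ?_
  have h1 : ∀ i j, ‖rankOne ℝ (e i) (e j)‖ = 1 := fun i j => by simp [he.1]
  have h2 : (s ^ 2) ^ n ≤ s ^ n := by
    rw [← pow_mul]
    exact pow_le_pow_of_le_one hs0 hs1.le (by omega)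
  calc ‖jacobiTerm e s n‖ ≤ s ^ n * (1 + 1) + (s ^ 2) ^ n * 1 := by
        refine (norm_add_le _ _).trans ?_
        rw [norm_smul, norm_smul, h1, Real.norm_of_nonneg (by positivity),
          Real.norm_of_nonneg (by positivity)]
        gcongr
        refine (norm_add_le _ _).trans ?_
        rw [h1, h1]
    _ ≤ 3 * s ^ n := by linarith

theorem isCompactOperator_jacobiOp (he : Orthonormal ℝ e) (hs0 : 0 ≤ s) (hs1 : s < 1) :
    IsCompactOperator (jacobiOp e s) := by
  refine isCompactOperator_of_tendsto (summable_jacobiTerm he hs0 hs1).hasSum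
    (Filter.Eventually.of_forall fun F => ?_)
  induction F using Finset.induction_on with
  | empty => simpa using isCompactOperator_zero
  | insert a F ha ih =>
    rw [Finset.sum_insert ha]
    exact (isCompactOperator_jacobiTerm e s a).add ih

theorem hasSum_jacobiOp_apply (he : Orthonormal ℝ e) (hs0 : 0 ≤ s) (hs1 : s < 1) (x : E) :
    HasSum (fun n => jacobiTerm e s n x) (jacobiOp e s x) :=
  (summable_jacobiTerm he hs0 hs1).hasSum.mapL (ContinuousLinearMap.apply ℝ E x)

theorem isSymmetric_jacobiOp (he : Orthonormal ℝ e) (hs0 : 0 ≤ s) (hs1 : s < 1) :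
    (jacobiOp e s).IsSymmetric := by
  intro x y
  have h1 := (hasSum_jacobiOp_apply he hs0 hs1 x).mapL (innerSL ℝ y)
  have h2 := (hasSum_jacobiOp_apply he hs0 hs1 y).mapL (innerSL ℝ x)
  simp only [innerSL_apply_apply] at h1 h2
  rw [ContinuousLinearMap.coe_coe, real_inner_comm]
  refine h1.unique (h2.congr_fun ?_)
  intro n
  rw [← inner_jacobiTerm_left, real_inner_comm]

theorem jacobiOp_apply_zero (he : Orthonormal ℝ e) (hs0 : 0 ≤ s) (hs1 : s < 1) :
    jacobiOp e s (e 0) = e 1 := by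
  have h : ∀ n, jacobiTerm e s n (e 0) = if n = 0 then e 1 else 0 := by
    intro n
    rcases n with _ | n <;>
      simp [jacobiTerm, orthonormal_iff_ite.1 he, he.1]
  have := hasSum_jacobiOp_apply he hs0 hs1 (e 0)
  simp only [h] at this
  exact this.unique (hasSum_ite_eq 0 (e 1))

theorem jacobiOp_apply_succ (he : Orthonormal ℝ e) (hs0 : 0 ≤ s) (hs1 : s < 1) (k : ℕ) :
    jacobiOp e s (e (k + 1)) =
      s ^ k • e k + (s ^ 2) ^ k • e (k + 1) + s ^ (k + 1) • e (k + 2) := by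
  -- Only the links from `e (k + 1)` to its two neighbours act on it; the diagonal entry is carried
  -- by the link below.
  have h : ∀ n, jacobiTerm e s n (e (k + 1)) =
      (if n = k then s ^ k • e k + (s ^ 2) ^ k • e (k + 1) else 0) +
      (if n = k + 1 then s ^ (k + 1) • e (k + 2) else 0) := by
    intro n
    by_cases h1 : n = k
    · subst h1
      simp [jacobiTerm, orthonormal_iff_ite.1 he, he.1]
    · by_cases h2 : n = k + 1
      · subst h2
        simp [jacobiTerm, orthonormal_iff_ite.1 he, he.1]
      · simp [jacobiTerm, orthonormal_iff_ite.1 he, h1, h2]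
  have := hasSum_jacobiOp_apply he hs0 hs1 (e (k + 1))
  simp only [h] at this
  exact this.unique ((hasSum_ite_eq k _).add (hasSum_ite_eq (k + 1) _))

/-- The Poisson polynomials of the Jacobi operator map `e 0` to multiples of the `e n`. -/
theorem aeval_jacobiOp_poissonPoly (he : Orthonormal ℝ e) (hs0 : 0 ≤ s) (hs1 : s < 1) (n : ℕ) :
    aeval (jacobiOp e s) (poissonPoly 0 (s ^ 2) n) (e 0) =
      (∏ i ∈ Finset.range n, s ^ i) • e n := by
  induction n using Nat.twoStepInduction with
  | zero => simp [poissonPoly]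
  | one => simp [poissonPoly, jacobiOp_apply_zero he hs0 hs1]
  | more n ih0 ih1 =>
    rw [poissonPoly_zero_left_add_two]
    simp only [map_sub, map_mul, aeval_X, aeval_C, sub_apply,
      mul_apply_eq_comp, ih0, ih1, map_smul, jacobiOp_apply_succ he hs0 hs1,
      Algebra.algebraMap_eq_smul_one, smul_apply,
      one_apply_eq_self, Finset.prod_range_succ]
    -- The `e n` terms cancel because the product up to `n + 1` times `s ^ n` equals the product up
    -- to `n` times `(s ^ 2) ^ n`.
    module

end Jacobi

/-- Existence of the `t`-free Poisson distribution, as the spectral measure of a compact Jacobi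
operator. -/
theorem exists_isPoissonMeasure {t : ℝ} (ht0 : 0 < t) (ht1 : t < 1) :
    ∃ μ : Measure ℝ, IsPoissonMeasure 0 t μ ∧ IsPurelyDiscrete μ ∧
      ∃ R : ℝ, 0 ≤ R ∧ ∀ᵐ y ∂μ, y ∈ Set.Icc (-R) R := by
  -- Normalising the monic polynomials turns the coefficient `t ^ n` of `P_n` into an off-diagonal
  -- entry equal to its square root.
  set s := √t with hs
  have hst : s ^ 2 = t := Real.sq_sqrt ht0.le
  have hs0 : 0 ≤ s := Real.sqrt_nonneg t
  have hs1 : s < 1 := by rw [hs, Real.sqrt_lt' one_pos]; simpa using ht1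
  let b : HilbertBasis ℕ ℝ (lp (fun _ : ℕ => ℝ) 2) := ⟨LinearIsometryEquiv.refl ℝ _⟩
  have he := b.orthonormal
  set J := jacobiOp b s with hJ
  have hsymm := isSymmetric_jacobiOp he hs0 hs1
  obtain ⟨μ, h1, h2, h3, h4⟩ := exists_discrete_spectral_measure J
    (isCompactOperator_jacobiOp he hs0 hs1) hsymm (b 0) (he.1 0)
  have hint : ∀ n : ℕ, Integrable (fun y : ℝ => y ^ n) μ := fun n =>
    integrable_of_ae_mem_Icc h3 (continuous_pow n)
  have hpoly : ∀ p : ℝ[X], ∫ y, p.eval y ∂μ = ⟪b 0, aeval J p (b 0)⟫_ℝ := by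
    intro p
    simp only [eval_eq_sum_range, aeval_eq_sum_range]
    rw [integral_finsetSum _ fun i _ => (hint i).const_mul _, sum_apply,
      inner_sum]
    simp only [integral_const_mul, h4, smul_apply, inner_smul_right]
  have hpow : ∀ (n : ℕ) (x y : lp (fun _ : ℕ => ℝ) 2), ⟪(J ^ n) x, y⟫_ℝ = ⟪x, (J ^ n) y⟫_ℝ := by
    intro n
    induction n with
    | zero => simp
    | succ n ih =>
      intro x y
      have h := hsymm ((J ^ n) x) y
      simp only [ContinuousLinearMap.coe_coe] at h
      rw [pow_succ', mul_apply_eq_comp, h, ih, ← mul_apply_eq_comp, ← pow_succ, pow_succ']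
  have hadj : ∀ (p : ℝ[X]) (x y : lp (fun _ : ℕ => ℝ) 2),
      ⟪aeval J p x, y⟫_ℝ = ⟪x, aeval J p y⟫_ℝ := by
    intro p x y
    simp only [aeval_eq_sum_range, sum_apply, sum_inner, inner_sum,
      smul_apply, inner_smul_left, inner_smul_right, hpow, conj_trivial]
  refine ⟨μ, ⟨h1, hint, fun m n hmn => ?_⟩, h2, ‖J‖, norm_nonneg _, h3⟩
  simp only [← eval_mul]
  -- By symmetry of `J`, the integral of `P_m P_n` is the inner product of `P_m(J) e 0` and `P_n(J)
  -- e 0`, multiples of distinct basis vectors.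
  rw [hpoly, map_mul, mul_apply_eq_comp, ← hadj, ← hst, aeval_jacobiOp_poissonPoly he hs0 hs1,
    aeval_jacobiOp_poissonPoly he hs0 hs1, inner_smul_left, inner_smul_right, he.2 hmn]
  simp

/-! ### The vacuum law -/

section VacuumLaw

variable {H : Type*} [NormedAddCommGroup H] [InnerProductSpace ℂ H]

/-- The vector `x ⊗ ⋯ ⊗ x` of the Fock space. -/
noncomputable def powVec (x : H) (n : ℕ) : Fock H :=
  DirectSum.lof ℂ ℕ (fun n => ⨂[ℂ]^n H) n (PiTensorProduct.tprod ℂ fun _ => x)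

theorem powVec_zero (x : H) : powVec x 0 = vacuum H := by
  rw [powVec, vacuum]
  congr 2
  exact Subsingleton.elim _ _

theorem creation_powVec (x : H) (n : ℕ) : creation x (powVec x n) = powVec x (n + 1) := by
  rw [powVec, creation, DirectSum.toModule_lof, LinearMap.comp_apply, PiTensorProduct.lift.tprod,
    MultilinearMap.curryMid_apply_apply, powVec]
  congr 2
  ext i
  refine Fin.lastCases ?_ (fun i => ?_) i <;> simp

theorem annihilation_powVec_zero (q t : ℝ) (x : H) : annihilation q t x (powVec x 0) = 0 := by
  rw [powVec, annihilation, DirectSum.toModule_lof, LinearMap.zero_apply]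

theorem gauge_powVec_zero (q t : ℝ) (T : H →L[ℂ] H) (x : H) : gauge q t T (powVec x 0) = 0 := by
  rw [powVec, gauge, DirectSum.toModule_lof, LinearMap.zero_apply]

/-- The weight `t ^ k * 0 ^ (n - k)` vanishes except at the last slot `k = n`, where `0 ^ 0 = 1`.
The gauge operator reduces in the same way. -/
theorem annihilation_powVec_succ (t : ℝ) (x : H) (hx : ‖x‖ = 1) (n : ℕ) :
    annihilation 0 t x (powVec x (n + 1)) = (t : ℂ) ^ n • powVec x n := by
  rw [powVec, annihilation, DirectSum.toModule_lof, LinearMap.comp_apply, annihilationAux,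
    PiTensorProduct.lift.tprod, sum_apply, Fin.sum_univ_castSucc,
    Finset.sum_eq_zero]
  · simp [powVec, inner_self_eq_norm_sq_to_K, hx]
    rfl
  · intro k _
    have : n - (k : ℕ) ≠ 0 := by have := k.2; omega
    simp [this]

theorem gauge_powVec_succ (t : ℝ) (x : H) (n : ℕ) :
    gauge 0 t (ContinuousLinearMap.id ℂ H) (powVec x (n + 1)) = (t : ℂ) ^ n • powVec x (n + 1) := by
  rw [powVec, gauge, DirectSum.toModule_lof, LinearMap.comp_apply, gaugeAux,
    PiTensorProduct.lift.tprod, sum_apply, Fin.sum_univ_castSucc,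
    Finset.sum_eq_zero]
  · simp
  · intro k _
    have : n - (k : ℕ) ≠ 0 := by have := k.2; omega
    simp [this]

theorem opY_powVec_zero (q t : ℝ) (T : H →L[ℂ] H) (x : H) :
    opY q t T x (powVec x 0) = powVec x 1 := by
  simp [opY, annihilation_powVec_zero, gauge_powVec_zero, creation_powVec]

theorem opY_powVec_succ (t : ℝ) (x : H) (hx : ‖x‖ = 1) (n : ℕ) :
    opY 0 t (ContinuousLinearMap.id ℂ H) x (powVec x (n + 1)) =
      (t : ℂ) ^ n • powVec x n + powVec x (n + 2) + (t : ℂ) ^ n • powVec x (n + 1) := by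
  simp only [opY, LinearMap.add_apply, annihilation_powVec_succ t x hx, creation_powVec,
    gauge_powVec_succ]

/-- The Poisson polynomials of `Y` create the vectors `x ⊗ ⋯ ⊗ x` from the vacuum. -/
theorem aeval_opY_poissonPoly (t : ℝ) (x : H) (hx : ‖x‖ = 1) (n : ℕ) :
    aeval (opY 0 t (ContinuousLinearMap.id ℂ H) x)
      ((poissonPoly 0 t n).map Complex.ofRealHom) (vacuum H) = powVec x n := by
  rw [← powVec_zero x]
  induction n using Nat.twoStepInduction with
  | zero => simp [poissonPoly]
  | one => simp [poissonPoly, opY_powVec_zero]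
  | more n ih0 ih1 =>
    rw [poissonPoly_zero_left_add_two]
    simp only [Polynomial.map_sub, Polynomial.map_mul, map_X, map_C, map_sub, map_mul, aeval_X,
      aeval_C, LinearMap.sub_apply, Module.End.mul_apply, ih0, ih1, opY_powVec_succ t x hx,
      Module.algebraMap_end_apply, Complex.ofRealHom_eq_coe, Complex.ofReal_pow]
    abel

theorem fockInner_add_right (q t : ℝ) (f g h : Fock H) :
    fockInner q t f (g + h) = fockInner q t f g + fockInner q t f h := map_add _ g h

theorem fockInner_smul_right (q t : ℝ) (f g : Fock H) (c : ℂ) :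
    fockInner q t f (c • g) = c * fockInner q t f g := map_smul _ c g

theorem tensorInner_zero_left (n : ℕ) : tensorInner n (0 : ⨂[ℂ]^n H) = 0 :=
  map_zero (PiTensorProduct.lift (innerMulti H n))

/-- The vacuum lives in degree `0`, where the only permutation has no inversions and the symmetrizer
is the identity, so the deformation plays no role. -/
theorem fockInner_vacuum_powVec (q t : ℝ) (x : H) (n : ℕ) :
    fockInner q t (vacuum H) (powVec x n) = if n = 0 then 1 else 0 := by
  rw [fockInner, powVec, DirectSum.toModule_lof, LinearMap.comp_apply]
  rcases n with _ | n
  · have h : vacuum H 0 = PiTensorProduct.tprod ℂ (Fin.elim0 : Fin 0 → H) :=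
      DirectSum.lof_apply ℂ 0 _
    have hsymm : symmetrizer q t 0 (PiTensorProduct.tprod ℂ fun _ => x) =
        PiTensorProduct.tprod ℂ fun _ : Fin 0 => x := by
      have : inversions (1 : Equiv.Perm (Fin 0)) = 0 := by simp [inversions]
      simp [symmetrizer, this]
    rw [h, hsymm, tensorInner_tprod]
    simp
  · have h : vacuum H (n + 1) = 0 := DFinsupp.single_eq_of_ne (by simp)
    rw [h, tensorInner_zero_left]
    simp

/-- Both sides are linear in `p`, and on the spanning family `P_n` both equal `1` for `n = 0` and
`0` otherwise. -/
theorem vacuumState_opY_eq_integral {t : ℝ} {μ : Measure ℝ} (hμ : IsPoissonMeasure 0 t μ) (x : H)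
    (hx : ‖x‖ = 1) (p : ℝ[X]) :
    vacuumState 0 t (aeval (opY 0 t (ContinuousLinearMap.id ℂ H) x) (p.map Complex.ofRealHom)) =
      ((∫ y, p.eval y ∂μ : ℝ) : ℂ) := by
  have hp : p ∈ Submodule.span ℝ (Set.range (poissonPoly 0 t)) := by simp [span_poissonPoly]
  rw [vacuumState]
  induction hp using Submodule.span_induction with
  | mem p hp =>
    obtain ⟨n, rfl⟩ := hp
    rw [aeval_opY_poissonPoly t x hx, fockInner_vacuum_powVec, hμ.integral_poissonPoly]
    split_ifs <;> simp
  | zero => simp [fockInner]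
  | add p r _ _ hp hr =>
    simp only [eval_add]
    rw [integral_add (integrable_eval hμ.integrable_pow p) (integrable_eval hμ.integrable_pow r),
      Polynomial.map_add, map_add, LinearMap.add_apply, fockInner_add_right, hp, hr,
      Complex.ofReal_add]
  | smul a p _ hp =>
    simp only [eval_smul, smul_eq_mul, integral_const_mul]
    rw [smul_eq_C_mul, Polynomial.map_mul, map_C, map_mul, aeval_C, Module.End.mul_apply,
      Module.algebraMap_end_apply, fockInner_smul_right, hp, Complex.ofReal_mul]
    rfl

theorem IsPoissonMeasure.isVacuumLaw {t : ℝ} {μ : Measure ℝ} (hμ : IsPoissonMeasure 0 t μ) (x : H)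
    (hx : ‖x‖ = 1) : IsVacuumLaw 0 t (opY 0 t (ContinuousLinearMap.id ℂ H) x) μ where
  isProbabilityMeasure := hμ.isProbabilityMeasure
  integrable_pow := hμ.integrable_pow
  moment_eq n := by simpa using vacuumState_opY_eq_integral hμ x hx (X ^ n)

end VacuumLaw

end QTFock

/-! ### Existence, determinacy and the vacuum law combined. -/

theorem mainTheorem7 (t : ℝ) (ht0 : 0 < t) (ht1 : t < 1) :
    (∃! μ : Measure ℝ, QTFock.IsPoissonMeasure 0 t μ) ∧
    ∀ μ : Measure ℝ, QTFock.IsPoissonMeasure 0 t μ →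
      QTFock.IsPurelyDiscrete μ ∧ Bornology.IsBounded μ.support ∧
      ∀ (H : Type*) [NormedAddCommGroup H] [InnerProductSpace ℂ H] [CompleteSpace H]
        (x : H), ‖x‖ = 1 →
        ∀ ν : Measure ℝ,
          QTFock.IsVacuumLaw 0 t (QTFock.opY 0 t (ContinuousLinearMap.id ℂ H) x) ν ↔ ν = μ := by
  obtain ⟨μ₀, h₀, hdisc, R, hR, hIcc⟩ := QTFock.exists_isPoissonMeasure ht0 ht1
  have := h₀.isProbabilityMeasure
  have huniq : ∀ μ : Measure ℝ, QTFock.IsPoissonMeasure 0 t μ → μ = μ₀ := fun μ hμ =>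
    have := hμ.isProbabilityMeasure
    (QTFock.ext_of_moments hR hIcc hμ.integrable_pow (h₀.moments_eq hμ)).symm
  refine ⟨⟨μ₀, h₀, huniq⟩, fun μ hμ => ?_⟩
  obtain rfl := huniq μ hμ
  refine ⟨hdisc, (Metric.isBounded_Icc (-R) R).subset
    (Measure.support_subset_of_isClosed isClosed_Icc hIcc), ?_⟩
  intro H _ _ _ x hx ν
  refine ⟨fun hν => ?_, fun h => h ▸ hμ.isVacuumLaw x hx⟩
  have := hν.isProbabilityMeasure
  -- Only `μ` is known to have bounded support; for `ν`, finite moments suffice.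
  refine (QTFock.ext_of_moments hR hIcc hν.integrable_pow fun n => ?_).symm
  exact_mod_cast ((hμ.isVacuumLaw x hx).moment_eq n).symm.trans (hν.moment_eq n)
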